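/- Let $V$ be a nonempty finite set and $t\ge 2$ an integer. A sequence $(E_1,\dots,E_k)$ of sets of edges on $V$ is called $t$-pg if for every $i\in\{1,\dots,k\}$ the set $E_i$ is a matching (a set of pairwise disjoint edges) and $d_{G_{i-1}}(u,v)>t$ for every $\{u,v\}\in E_i$, where $G_{i-1}$ is the graph on $V$ with edge set $\bigcup_{1\le j\le i-1}E_j$ and $d_{G_{i-1}}$ is its shortest-path distance (infinite between different components). A graph $G$ on $V$ is called $t$-pg if its edge set is the union of some $t$-pg sequence on $V$. The arboricity of $G$ is the minimum number of pairwise edge-disjoint forests whose union is $G$. Theorem. Every $t$-pg graph on $n$ vertices has arboricity at most $t^3\cdot\log^3 n\cdot n^{O(1/t)}$. That is, there is a universal constant $C>0$ such that for every integer $t\ge 2$, every $n\ge 1$, and every $t$-pg graph $G$ on $n$ vertices, the arboricity of $G$ is at most $t^3\cdot(\ln n)^3\cdot n^{C/t}$. -/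

import Mathlib

namespace PG

variable {V : Type*}

/-- A set of edges (unordered pairs of distinct vertices) that are pairwise disjoint. -/
def IsEdgeMatching (M : Set (Sym2 V)) : Prop :=
  (∀ e ∈ M, ¬ e.IsDiag) ∧
    ∀ e ∈ M, ∀ f ∈ M, e ≠ f → ∀ v : V, ¬ (v ∈ e ∧ v ∈ f)

/-- The graph `G_{i-1}` whose edges are those of all the edge sets that precede `E i`. -/
def earlierGraph {k : ℕ} (E : Fin k → Set (Sym2 V)) (i : Fin k) : SimpleGraph V :=
  SimpleGraph.fromEdgeSet (⋃ j : Fin k, ⋃ _ : j < i, E j)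

/-- A `t`-pg sequence of edge sets: each one is a matching, and the endpoints of each of its edges
are at distance more than `t` in the graph formed by the earlier ones (the distance is `⊤`
between different connected components). -/
def IsPGSequence (t : ℕ) {k : ℕ} (E : Fin k → Set (Sym2 V)) : Prop :=
  ∀ i : Fin k, IsEdgeMatching (E i) ∧
    ∀ u v : V, s(u, v) ∈ E i → (t : ℕ∞) < (earlierGraph E i).edist u v

/-- A `t`-pg graph: its edge set is the union of some `t`-pg sequence. -/
def IsPGGraph (t : ℕ) (G : SimpleGraph V) : Prop :=
  ∃ (k : ℕ) (E : Fin k → Set (Sym2 V)), IsPGSequence t E ∧ G.edgeSet = ⋃ i, E i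

/-- A forest cover of `G` of size `k`: edge-disjoint forests `F 0, …, F (k-1)` with union `G`. -/
def IsForestCover (G : SimpleGraph V) {k : ℕ} (F : Fin k → SimpleGraph V) : Prop :=
  (∀ i, (F i).IsAcyclic) ∧
    (∀ i j, i ≠ j → Disjoint (F i).edgeSet (F j).edgeSet) ∧
    (⋃ i, (F i).edgeSet) = G.edgeSet

/-- The arboricity: the minimum size of a forest cover. On a finite vertex set a forest cover
exists (`exists_isForestCover`), so that the minimum is attained. -/
noncomputable def arboricity (G : SimpleGraph V) : ℕ :=
  sInf {k : ℕ | ∃ F : Fin k → SimpleGraph V, IsForestCover G F}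

theorem exists_isForestCover [Finite V] (G : SimpleGraph V) :
    ∃ (k : ℕ) (F : Fin k → SimpleGraph V), IsForestCover G F := by
  obtain ⟨k, ⟨f⟩⟩ := Finite.exists_equiv_fin G.edgeSet
  have hE : ∀ i, (SimpleGraph.fromEdgeSet {((f.symm i : G.edgeSet) : Sym2 V)}).edgeSet
      = {((f.symm i : G.edgeSet) : Sym2 V)} := by
    intro i
    rw [SimpleGraph.edgeSet_fromEdgeSet, sdiff_eq_left, Set.disjoint_singleton_left]
    exact G.not_isDiag_of_mem_edgeSet (f.symm i).2
  refine ⟨k, fun i => SimpleGraph.fromEdgeSet {((f.symm i : G.edgeSet) : Sym2 V)}, ?_, ?_, ?_⟩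
  · intro i v c hc
    have h3 := hc.three_le_length
    have hsub : ∀ e ∈ c.edges, e = ((f.symm i : G.edgeSet) : Sym2 V) := by
      intro e he
      have := c.edges_subset_edgeSet he
      rw [hE] at this
      exact this
    have hle : c.edges.length ≤ 1 := by
      have hn := hc.edges_nodup
      match h : c.edges with
      | [] => simp
      | [a] => simp
      | a :: b :: l =>
        rw [h] at hn hsub
        have h1 := hsub a (by simp)
        have h2 := hsub b (by simp)
        simp [h1, h2] at hn
    rw [SimpleGraph.Walk.length_edges] at hle
    omega
  · intro i j hij
    rw [hE, hE, Set.disjoint_singleton]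
    intro h
    exact hij (f.symm.injective (Subtype.ext h))
  · ext e
    simp only [hE, Set.mem_iUnion, Set.mem_singleton_iff]
    constructor
    · rintro ⟨i, rfl⟩
      exact (f.symm i).2
    · intro he
      exact ⟨f ⟨e, he⟩, by simp⟩

end PG

/-!
Order the edges of a `t`-pg graph by the index of their matching, and consider walks along which
the index strictly increases. If two different increasing walks of length at most `(t + 1) / 2`
had the same two ends, then the last edge of one of them (after cancelling common last edges) would
be joined end to end by at most `t` earlier edges. So at most `n` increasing walks of a given such
length end at a vertex. For the recursively built sets `starts` of starting points this is the
disjointness `disjoint_starts`.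

On the other hand a dense graph has many increasing walks. Put a pedestrian on each vertex and let
the pedestrians at the two ends of an edge swap places with probability `p` when the edge's turn
comes. The expected number of moves is `p` times the sum of the degrees, every trail is an
increasing walk, and a given increasing walk of length `ℓ` is followed with probability at most
`p ^ ℓ`. A counter that is reset at every `ℓ`-th move of a pedestrian compares the two counts
(`sum_card_moved_le`). With `ℓ = (t + 1) / 2` and `p = n ^ (-1 / ℓ)`, every nonempty vertex set has
a vertex with at most `t * n ^ (2 / t)` neighbours in it. A graph that is degenerate in this sense
splits into as many forests (`arboricity_le_of_degenerate`), so the arboricity is at most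
`t * n ^ (2 / t)`. For `n ≥ 2` this is less than the claimed bound with `C = 2`, as
`t ^ 2 * log n ^ 3 ≥ 4 * log 2 ^ 3 > 1`.
-/

namespace PG

variable {V : Type*}

/-! ### Increasing walks -/

section Walks

variable [DecidableEq V]

/-- Let the involutions `σ 0, σ 1, …` record matchings: `v` is matched to `σ i v` at time `i` if
`σ i v ≠ v`, and unmatched otherwise. `starts σ i j v` is the set of starting points of the walks
of length `j` that end at `v` and use edges of strictly increasing times, all less than `i`. -/
def starts (σ : ℕ → V → V) : ℕ → ℕ → V → Finset V
  | _, 0, v => {v}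
  | 0, _ + 1, _ => ∅
  | i + 1, j + 1, v =>
    if σ i v = v then starts σ i (j + 1) v
    else starts σ i (j + 1) v ∪ starts σ i j (σ i v)

theorem starts_zero (σ : ℕ → V → V) (i : ℕ) (v : V) : starts σ i 0 v = {v} := by
  cases i <;> simp [starts]

theorem edist_le_of_mem_starts {σ : ℕ → V → V} {H : ℕ → SimpleGraph V} (hH : Monotone H)
    (hadj : ∀ i v, σ i v ≠ v → (H (i + 1)).Adj (σ i v) v) {i j : ℕ} {v w : V}
    (hw : w ∈ starts σ i j v) : (H i).edist w v ≤ j := by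
  induction i generalizing j v with
  | zero => cases j <;> simp_all [starts]
  | succ i ih =>
    cases j with
    | zero => simp_all [starts]
    | succ j =>
      have hmono : ∀ a b, (H (i + 1)).edist a b ≤ (H i).edist a b := fun a b =>
        SimpleGraph.edist_anti (hH i.le_succ)
      rw [starts] at hw
      split_ifs at hw with hv
      · exact (hmono _ _).trans (ih hw)
      · rcases Finset.mem_union.1 hw with hw | hw
        · exact (hmono _ _).trans (ih hw)
        · refine (SimpleGraph.edist_triangle (v := σ i v)).trans ?_
          push_cast
          exact add_le_add ((hmono _ _).trans (ih hw))
            (SimpleGraph.edist_eq_one_iff_adj.2 (hadj i v hv)).le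

/-- The walks that end with the new edge at `v` have other starting points than the older walks
to `v` of the same length: a common starting point would join `v` to `σ i v` by a short walk
of older edges. -/
theorem disjoint_starts {σ : ℕ → V → V} {H : ℕ → SimpleGraph V} (hH : Monotone H)
    (hadj : ∀ i v, σ i v ≠ v → (H (i + 1)).Adj (σ i v) v) {t : ℕ}
    (hfar : ∀ i v, σ i v ≠ v → (t : ℕ∞) < (H i).edist (σ i v) v)
    {i j : ℕ} (hj : 2 * j + 1 ≤ t) {v : V} (hv : σ i v ≠ v) :
    Disjoint (starts σ i (j + 1) v) (starts σ i j (σ i v)) := by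
  rw [Finset.disjoint_left]
  intro w h1 h2
  have h3 : (H i).edist (σ i v) v ≤ (j : ℕ∞) + ((j + 1 : ℕ) : ℕ∞) := by
    refine (SimpleGraph.edist_triangle (v := w)).trans (add_le_add ?_ ?_)
    · rw [SimpleGraph.edist_comm]
      exact edist_le_of_mem_starts hH hadj h2
    · exact edist_le_of_mem_starts hH hadj h1
  have h4 := (hfar i v hv).trans_le h3
  norm_cast at h4
  omega

/-! ### Random pedestrians -/

/-- Pedestrians, one on each vertex, independently swap places along each matching edge with
probability `p`. Each carries a counter, which starts at `0`, increases by one at every move, and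
jumps from `q` back to `0`. `counterLaw σ p q i j v` is the probability that, before time `i`, the
pedestrian standing on `v` has counter `j`. -/
def counterLaw (σ : ℕ → V → V) (p : ℝ) (q : ℕ) : ℕ → ℕ → V → ℝ
  | 0, j, _ => if j = 0 then 1 else 0
  | i + 1, j, v =>
    if σ i v = v then counterLaw σ p q i j v
    else (1 - p) * counterLaw σ p q i j v +
      p * (if j = 0 then counterLaw σ p q i q (σ i v) else counterLaw σ p q i (j - 1) (σ i v))

variable {σ : ℕ → V → V} {p : ℝ} {q : ℕ}

theorem counterLaw_nonneg (h0 : 0 ≤ p) (h1 : p ≤ 1) (i j : ℕ) (v : V) :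
    0 ≤ counterLaw σ p q i j v := by
  induction i generalizing j v with
  | zero => rw [counterLaw]; split_ifs <;> simp
  | succ i ih =>
    have h2 : 0 ≤ 1 - p := by linarith
    have h3 := fun j v => mul_nonneg h2 (ih j v)
    have h4 := fun j v => mul_nonneg h0 (ih j v)
    rw [counterLaw]
    split_ifs
    · exact ih _ _
    · exact add_nonneg (h3 _ _) (h4 _ _)
    · exact add_nonneg (h3 _ _) (h4 _ _)

theorem sum_counterLaw (i : ℕ) (v : V) :
    ∑ j ∈ Finset.range (q + 1), counterLaw σ p q i j v = 1 := by
  induction i generalizing v with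
  | zero => simp [counterLaw]
  | succ i ih =>
    by_cases hv : σ i v = v
    · simp [counterLaw, hv, ih]
    · simp only [counterLaw, hv, if_false]
      rw [Finset.sum_add_distrib, ← Finset.mul_sum, ← Finset.mul_sum, ih,
        Finset.sum_range_succ']
      have := ih (σ i v)
      rw [Finset.sum_range_succ] at this
      simp [this]

/-- A pedestrian with counter `j` on `v` has made its last `j` moves along an increasing walk
to `v`, and these moves have probability `p ^ j`. -/
theorem counterLaw_le (h0 : 0 ≤ p) (h1 : p ≤ 1) {t : ℕ} (hq : 2 * q + 1 ≤ t)
    {H : ℕ → SimpleGraph V} (hH : Monotone H)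
    (hadj : ∀ i v, σ i v ≠ v → (H (i + 1)).Adj (σ i v) v)
    (hfar : ∀ i v, σ i v ≠ v → (t : ℕ∞) < (H i).edist (σ i v) v) (i : ℕ) {j : ℕ} (hj : j ≤ q)
    (v : V) : counterLaw σ p q i j v ≤ p ^ j * (starts σ i j v).card := by
  induction i generalizing j v with
  | zero => cases j <;> simp [counterLaw, starts]
  | succ i ih =>
    cases j with
    | zero =>
      rw [starts_zero]
      simp only [pow_zero, Finset.card_singleton, Nat.cast_one, mul_one]
      rw [← sum_counterLaw (σ := σ) (p := p) (q := q) (i + 1) v]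
      exact Finset.single_le_sum (fun j _ => counterLaw_nonneg h0 h1 (i + 1) j v) (by simp)
    | succ j =>
      by_cases hv : σ i v = v
      · simpa [counterLaw, starts, hv] using ih hj v
      · simp only [counterLaw, starts, hv, if_false, Nat.add_sub_cancel, Nat.succ_ne_zero]
        rw [Finset.card_union_of_disjoint
          (disjoint_starts hH hadj hfar (by omega) hv)]
        push_cast
        have h2 := ih hj v
        have h3 := mul_le_mul_of_nonneg_left (ih (j := j) (by omega) (σ i v)) h0
        have h4 := mul_nonneg h0 (counterLaw_nonneg (σ := σ) (q := q) h0 h1 i (j + 1) v)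
        rw [pow_succ] at h2 ⊢
        nlinarith

/-- The expected counter of the pedestrian on `v`. -/
def counterMean (σ : ℕ → V → V) (p : ℝ) (q i : ℕ) (v : V) : ℝ :=
  ∑ j ∈ Finset.range (q + 1), (j : ℝ) * counterLaw σ p q i j v

theorem counterMean_zero (v : V) : counterMean σ p q 0 v = 0 := by
  refine Finset.sum_eq_zero fun j _ => ?_
  by_cases hj : j = 0 <;> simp [counterLaw, hj]

theorem counterMean_le (h0 : 0 ≤ p) (h1 : p ≤ 1) (i : ℕ) (v : V) :
    counterMean σ p q i v ≤ q := by
  calc counterMean σ p q i v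
      ≤ ∑ j ∈ Finset.range (q + 1), (q : ℝ) * counterLaw σ p q i j v := by
        refine Finset.sum_le_sum fun j hj => ?_
        refine mul_le_mul_of_nonneg_right ?_ (counterLaw_nonneg h0 h1 _ _ _)
        exact_mod_cast Nat.lt_succ_iff.1 (Finset.mem_range.1 hj)
    _ = q := by rw [← Finset.mul_sum, sum_counterLaw, mul_one]

theorem counterMean_succ_of_eq {i : ℕ} {v : V} (hv : σ i v = v) :
    counterMean σ p q (i + 1) v = counterMean σ p q i v := by
  simp [counterMean, counterLaw, hv]

theorem counterMean_succ_of_ne {i : ℕ} {v : V} (hv : σ i v ≠ v) :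
    counterMean σ p q (i + 1) v = (1 - p) * counterMean σ p q i v +
      p * (counterMean σ p q i (σ i v) + 1 - (q + 1) * counterLaw σ p q i q (σ i v)) := by
  have key : ∑ j ∈ Finset.range (q + 1), (j : ℝ) *
      (if j = 0 then counterLaw σ p q i q (σ i v) else counterLaw σ p q i (j - 1) (σ i v)) =
      counterMean σ p q i (σ i v) + 1 - (q + 1) * counterLaw σ p q i q (σ i v) := by
    have h := sum_counterLaw (σ := σ) (p := p) (q := q) i (σ i v)
    rw [Finset.sum_range_succ] at h
    rw [counterMean, Finset.sum_range_succ', Finset.sum_range_succ]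
    simp only [Nat.succ_ne_zero, if_false, Nat.add_sub_cancel, Nat.cast_add, Nat.cast_one,
      add_mul, one_mul, Finset.sum_add_distrib, Nat.cast_zero, zero_mul, add_zero]
    linarith
  rw [← key, counterMean, counterMean, Finset.mul_sum, Finset.mul_sum, ← Finset.sum_add_distrib]
  refine Finset.sum_congr rfl fun j _ => ?_
  rw [counterLaw, if_neg hv]
  ring

/-- Every move raises a counter by one or resets it, and a reset costs `q + 1`. The resets are
paid for by the increasing walks of length `q + 1`, each of which has its own starting point. -/
theorem sum_card_moved_le (h0 : 0 ≤ p) (h1 : p ≤ 1) {t : ℕ} (hq : 2 * q + 1 ≤ t)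
    {H : ℕ → SimpleGraph V} (hH : Monotone H)
    (hadj : ∀ i v, σ i v ≠ v → (H (i + 1)).Adj (σ i v) v)
    (hfar : ∀ i v, σ i v ≠ v → (t : ℕ∞) < (H i).edist (σ i v) v)
    (hσ : ∀ i, Function.Involutive (σ i)) (U : Finset V) (hU : ∀ i, ∀ v ∈ U, σ i v ∈ U) (k : ℕ) :
    p * ∑ i ∈ Finset.range k, ((U.filter fun v => σ i v ≠ v).card : ℝ) ≤
      ∑ v ∈ U, (counterMean σ p q k v +
        (q + 1) * (p ^ (q + 1) * (starts σ k (q + 1) v).card)) := by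
  induction k with
  | zero => simp [counterMean_zero, starts]
  | succ i ih =>
    have hperm : ∑ v ∈ U, counterMean σ p q i (σ i v) = ∑ v ∈ U, counterMean σ p q i v :=
      Finset.sum_nbij' (σ i) (σ i) (hU i) (hU i) (fun v _ => hσ i v) (fun v _ => hσ i v)
        (fun v _ => rfl)
    have hstep : ∀ v ∈ U,
        ((1 - p) * counterMean σ p q i v + p * counterMean σ p q i (σ i v) +
          (q + 1) * (p ^ (q + 1) * (starts σ i (q + 1) v).card)) +
          p * (if σ i v ≠ v then 1 else 0) ≤
        counterMean σ p q (i + 1) v +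
          (q + 1) * (p ^ (q + 1) * (starts σ (i + 1) (q + 1) v).card) := by
      intro v _
      by_cases hv : σ i v = v
      · rw [counterMean_succ_of_eq hv]
        simp only [starts, hv, ne_eq, not_true_eq_false, if_false, if_true]
        linarith
      · rw [counterMean_succ_of_ne hv]
        simp only [starts, hv, ne_eq, not_false_eq_true, if_false, if_true]
        rw [Finset.card_union_of_disjoint (disjoint_starts hH hadj hfar hq hv)]
        have h2 := mul_le_mul_of_nonneg_left
          (counterLaw_le h0 h1 hq hH hadj hfar i le_rfl (σ i v)) h0
        have h3 : (0 : ℝ) ≤ q + 1 := by positivity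
        have h4 := mul_le_mul_of_nonneg_left h2 h3
        push_cast
        rw [pow_succ]
        linarith
    have hsum := Finset.sum_le_sum hstep
    rw [Finset.sum_add_distrib, Finset.sum_add_distrib, Finset.sum_add_distrib,
      ← Finset.mul_sum, ← Finset.mul_sum, hperm, ← Finset.mul_sum U _ p,
      ← Finset.natCast_card_filter] at hsum
    rw [Finset.sum_add_distrib] at ih
    rw [Finset.sum_range_succ, mul_add]
    linarith

end Walks

/-! ### Degeneracy of parallel greedy graphs -/

open Classical in
/-- The involution that swaps the ends of the edges of `M` inside `U`. -/
noncomputable def partner (M : Set (Sym2 V)) (U : Finset V) (v : V) : V :=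
  if h : ∃ w, v ∈ U ∧ w ∈ U ∧ s(v, w) ∈ M then h.choose else v

theorem partner_eq {M : Set (Sym2 V)} (hM : IsEdgeMatching M) {U : Finset V} {v w : V}
    (hv : v ∈ U) (hw : w ∈ U) (h : s(v, w) ∈ M) : partner M U v = w := by
  have hex : ∃ w, v ∈ U ∧ w ∈ U ∧ s(v, w) ∈ M := ⟨w, hv, hw, h⟩
  rw [partner, dif_pos hex]
  by_contra hne
  refine hM.2 _ hex.choose_spec.2.2 _ h (fun he => hne ?_) v ⟨by simp, by simp⟩
  exact Sym2.congr_right.1 he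

theorem partner_spec {M : Set (Sym2 V)} {U : Finset V} {v : V} (h : partner M U v ≠ v) :
    v ∈ U ∧ partner M U v ∈ U ∧ s(v, partner M U v) ∈ M := by
  by_cases hex : ∃ w, v ∈ U ∧ w ∈ U ∧ s(v, w) ∈ M
  · rw [partner, dif_pos hex]
    exact hex.choose_spec
  · exact absurd (by rw [partner, dif_neg hex]) h

theorem partner_mem {M : Set (Sym2 V)} {U : Finset V} {v : V} (hv : v ∈ U) :
    partner M U v ∈ U := by
  by_cases h : partner M U v = v
  · rwa [h]
  · exact (partner_spec h).2.1

theorem partner_involutive {M : Set (Sym2 V)} (hM : IsEdgeMatching M) (U : Finset V) :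
    Function.Involutive (partner M U) := by
  intro v
  by_cases h : partner M U v = v
  · rw [h, h]
  · obtain ⟨h1, h2, h3⟩ := partner_spec h
    exact partner_eq hM h2 h1 (by rwa [Sym2.eq_swap])

open Classical in
/-- Summing the degrees inside `U` counts the moves that `sum_card_moved_le` bounds, when only the
edges inside `U` are used. At most `card V` walks of length `q + 1` end at each vertex, because they
have distinct starting points. -/
theorem exists_card_neighbors_le [Fintype V] {t : ℕ} {G : SimpleGraph V} (hG : IsPGGraph t G)
    {q : ℕ} (hq : 2 * q + 1 ≤ t) {p : ℝ} (h0 : 0 ≤ p) (h1 : p ≤ 1)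
    (hp : p ^ (q + 1) * Fintype.card V ≤ 1) {U : Finset V} (hU : U.Nonempty) :
    ∃ v ∈ U, p * ((U.filter fun w => G.Adj v w).card : ℝ) ≤ 2 * q + 1 := by
  obtain ⟨k, E, hE, hGE⟩ := hG
  -- Times beyond the end of the sequence carry the empty matching.
  set M : ℕ → Set (Sym2 V) := fun i => {e | ∃ h : i < k, e ∈ E ⟨i, h⟩} with hMdef
  have hM : ∀ i, IsEdgeMatching (M i) := fun i =>
    ⟨fun e he => (hE ⟨i, he.1⟩).1.1 e he.2,
      fun e he f hf => (hE ⟨i, he.1⟩).1.2 e he.2 f hf.2⟩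
  set σ : ℕ → V → V := fun i => partner (M i) U
  set H : ℕ → SimpleGraph V := fun i =>
    SimpleGraph.fromEdgeSet (⋃ j : Fin k, ⋃ _ : j.1 < i, E j)
  have hH : Monotone H := by
    intro a b hab
    refine SimpleGraph.fromEdgeSet_mono (Set.iUnion_mono fun j => ?_)
    exact Set.iUnion_mono' fun h => ⟨h.trans_le hab, subset_rfl⟩
  have hadj : ∀ i v, σ i v ≠ v → (H (i + 1)).Adj (σ i v) v := by
    intro i v h
    obtain ⟨-, -, hi, he⟩ := partner_spec h
    rw [SimpleGraph.fromEdgeSet_adj]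
    refine ⟨Set.mem_iUnion₂.2 ⟨⟨i, hi⟩, i.lt_succ_self, ?_⟩, h⟩
    rwa [Sym2.eq_swap]
  have hfar : ∀ i v, σ i v ≠ v → (t : ℕ∞) < (H i).edist (σ i v) v := by
    intro i v h
    obtain ⟨-, -, hi, he⟩ := partner_spec h
    exact (hE ⟨i, hi⟩).2 _ _ (by rwa [Sym2.eq_swap])
  have hdeg : ∀ v ∈ U, (U.filter fun w => G.Adj v w).card ≤
      ((Finset.range k).filter fun i => σ i v ≠ v).card := by
    intro v hv
    refine Finset.card_le_card_of_surjOn (fun i => σ i v) ?_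
    intro w hw
    obtain ⟨hwU, hvw⟩ := Finset.mem_filter.1 hw
    have he : s(v, w) ∈ ⋃ i, E i := hGE ▸ (SimpleGraph.mem_edgeSet G).2 hvw
    obtain ⟨i, hi⟩ := Set.mem_iUnion.1 he
    have hσw : σ i v = w := partner_eq (hM i) hv hwU ⟨i.2, hi⟩
    exact ⟨i, by simp [hσw, hvw.ne'], hσw⟩
  by_contra! hcon
  have hsum := sum_card_moved_le h0 h1 hq hH hadj hfar
    (fun i => partner_involutive (hM i) U) U (fun i v hv => partner_mem hv) k
  have hle : ∑ v ∈ U, (counterMean σ p q k v +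
      (q + 1) * (p ^ (q + 1) * ((starts σ k (q + 1) v).card : ℝ))) ≤
      ∑ v ∈ U, (2 * q + 1 : ℝ) := by
    refine Finset.sum_le_sum fun v _ => ?_
    have h2 := counterMean_le (σ := σ) (q := q) h0 h1 k v
    have h3 : p ^ (q + 1) * ((starts σ k (q + 1) v).card : ℝ) ≤ 1 := by
      refine le_trans (mul_le_mul_of_nonneg_left ?_ (by positivity)) hp
      exact_mod_cast Finset.card_le_univ _
    have h4 : (0 : ℝ) ≤ q + 1 := by positivity
    nlinarith [mul_le_mul_of_nonneg_left h3 h4]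
  have hswap : ∑ i ∈ Finset.range k, ((U.filter fun v => σ i v ≠ v).card : ℝ) =
      ∑ v ∈ U, (((Finset.range k).filter fun i => σ i v ≠ v).card : ℝ) := by
    simp only [Finset.card_filter, Nat.cast_sum]
    exact Finset.sum_comm
  have hlt : ∑ v ∈ U, (2 * q + 1 : ℝ) <
      ∑ v ∈ U, p * (((Finset.range k).filter fun i => σ i v ≠ v).card : ℝ) := by
    refine Finset.sum_lt_sum_of_nonempty hU fun v hv => (hcon v hv).trans_le ?_
    exact mul_le_mul_of_nonneg_left (by exact_mod_cast hdeg v hv) h0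
  rw [← Finset.mul_sum, ← hswap] at hlt
  linarith

/-! ### Arboricity of degenerate graphs -/

theorem not_reachable_of_isolated {F : SimpleGraph V} {v w : V} (hv : ∀ u, ¬ F.Adj v u)
    (hvw : v ≠ w) : ¬ F.Reachable v w := by
  rintro ⟨c⟩
  cases c with
  | nil => exact hvw rfl
  | cons h _ => exact hv _ h

open Classical in
/-- Remove a vertex with at most `d` neighbours, and give its edges to different forests. -/
theorem exists_forests_of_degenerate (G : SimpleGraph V) (d : ℕ)
    (hd : ∀ U : Finset V, U.Nonempty → ∃ v ∈ U, (U.filter fun w => G.Adj v w).card ≤ d)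
    (U : Finset V) : ∃ F : Fin d → SimpleGraph V, (∀ c, (F c).IsAcyclic) ∧
      (∀ c c' u w, (F c).Adj u w → (F c').Adj u w → c = c') ∧
      ∀ u w, (∃ c, (F c).Adj u w) ↔ (G.Adj u w ∧ u ∈ U ∧ w ∈ U) := by
  induction hn : U.card generalizing U with
  | zero =>
    rw [Finset.card_eq_zero] at hn
    subst hn
    exact ⟨fun _ => ⊥, fun _ => SimpleGraph.isAcyclic_bot, by simp, by simp⟩
  | succ n ih =>
    obtain ⟨v, hv, hcard⟩ := hd U (Finset.card_pos.1 (by omega))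
    obtain ⟨F, hF1, hF2, hF3⟩ := ih (U.erase v) (by rw [Finset.card_erase_of_mem hv, hn]; rfl)
    set N := U.filter fun w => G.Adj v w with hN
    obtain ⟨f, hf⟩ : ∃ f : N → Fin d, Function.Injective f := by
      have : Nonempty (N ↪ Fin d) :=
        Function.Embedding.nonempty_of_card_le (by simpa using hcard)
      exact ⟨this.some, this.some.injective⟩
    have hiso : ∀ c u, ¬ (F c).Adj v u := fun c u h => by
      simpa using ((hF3 v u).1 ⟨c, h⟩).2.1
    have hiso' : ∀ c u, ¬ (F c).Adj u v := fun c u h => hiso c u h.symm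
    have hNG : ∀ w (hw : w ∈ N), w ∈ U ∧ G.Adj v w := fun w hw => Finset.mem_filter.1 hw
    let S : Fin d → SimpleGraph V := fun c =>
      SimpleGraph.fromEdgeSet {e | ∃ w : N, f w = c ∧ e = s(v, (w : V))}
    have hS : ∀ c u w, (S c).Adj u w ↔
        (u = v ∧ ∃ h : w ∈ N, f ⟨w, h⟩ = c) ∨ (w = v ∧ ∃ h : u ∈ N, f ⟨u, h⟩ = c) := by
      intro c u w
      rw [SimpleGraph.fromEdgeSet_adj]
      constructor
      · rintro ⟨⟨⟨x, hx⟩, hc, he⟩, hne⟩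
        rcases Sym2.eq_iff.1 he with ⟨rfl, rfl⟩ | ⟨rfl, rfl⟩
        · exact Or.inl ⟨rfl, hx, hc⟩
        · exact Or.inr ⟨rfl, hx, hc⟩
      · rintro (⟨rfl, h, hc⟩ | ⟨rfl, h, hc⟩)
        · exact ⟨⟨⟨w, h⟩, hc, rfl⟩, (hNG w h).2.ne⟩
        · exact ⟨⟨⟨u, h⟩, hc, Sym2.eq_swap⟩, (hNG u h).2.ne'⟩
    refine ⟨fun c => F c ⊔ S c, fun c => ?_, ?_, ?_⟩
    · by_cases hc : ∃ w, f w = c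
      · obtain ⟨w, hw⟩ := hc
        have hSc : S c = SimpleGraph.edge v (w : V) := by
          refine congrArg SimpleGraph.fromEdgeSet (Set.ext fun e => ?_)
          constructor
          · rintro ⟨x, hx, rfl⟩
            rw [hf (hx.trans hw.symm)]
            rfl
          · rintro rfl
            exact ⟨w, hw, rfl⟩
        change (F c ⊔ S c).IsAcyclic
        rw [hSc]
        exact (hF1 c).sup_edge_of_not_reachable
          (not_reachable_of_isolated (hiso c) (hNG w w.2).2.ne)
      · have hSc : S c = ⊥ := by
          ext u w
          rw [hS]
          simp only [SimpleGraph.bot_adj, iff_false]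
          rintro (⟨-, h, h'⟩ | ⟨-, h, h'⟩) <;> exact hc ⟨_, h'⟩
        change (F c ⊔ S c).IsAcyclic
        rw [hSc, sup_bot_eq]
        exact hF1 c
    · intro c c' u w h h'
      rw [SimpleGraph.sup_adj, hS] at h h'
      rcases h with h | ⟨rfl, h, rfl⟩ | ⟨rfl, h, rfl⟩ <;>
      rcases h' with h' | ⟨h1, h', rfl⟩ | ⟨h1, h', rfl⟩
      · exact hF2 _ _ _ _ h h'
      · exact absurd h (h1 ▸ hiso _ _)
      · exact absurd h (h1 ▸ hiso' _ _)
      · exact absurd h' (hiso _ _)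
      · rfl
      · exact absurd h1 (hNG w h).2.ne'
      · exact absurd h' (hiso' _ _)
      · exact absurd h1 (hNG u h).2.ne'
      · rfl
    · intro u w
      simp only [SimpleGraph.sup_adj, exists_or, hF3, hS, Finset.mem_erase]
      constructor
      · rintro (⟨h, ⟨-, hu⟩, -, hw⟩ | ⟨c, rfl, h, -⟩ | ⟨c, rfl, h, -⟩)
        · exact ⟨h, hu, hw⟩
        · exact ⟨(hNG w h).2, hv, (hNG w h).1⟩
        · exact ⟨(hNG u h).2.symm, (hNG u h).1, hv⟩
      · rintro ⟨h, hu, hw⟩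
        by_cases huv : u = v
        · subst huv
          exact Or.inr (Or.inl ⟨_, rfl, Finset.mem_filter.2 ⟨hw, h⟩, rfl⟩)
        by_cases hwv : w = v
        · subst hwv
          exact Or.inr (Or.inr ⟨_, rfl, Finset.mem_filter.2 ⟨hu, h.symm⟩, rfl⟩)
        exact Or.inl ⟨h, ⟨huv, hu⟩, hwv, hw⟩

open Classical in
theorem arboricity_le_of_degenerate [Fintype V] (G : SimpleGraph V) (d : ℕ)
    (hd : ∀ U : Finset V, U.Nonempty → ∃ v ∈ U, (U.filter fun w => G.Adj v w).card ≤ d) :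
    arboricity G ≤ d := by
  obtain ⟨F, h1, h2, h3⟩ := exists_forests_of_degenerate G d hd Finset.univ
  refine Nat.sInf_le ⟨F, h1, fun c c' hc => ?_, ?_⟩
  · rw [Set.disjoint_left]
    rintro ⟨u, w⟩ h h'
    exact hc (h2 c c' u w h h')
  · ext ⟨u, w⟩
    simpa using h3 u w

/-! ### The bound -/

theorem arboricity_le_mul_rpow [Fintype V] [Nonempty V] {t : ℕ} (ht : 1 ≤ t) {G : SimpleGraph V}
    (hG : IsPGGraph t G) :
    (arboricity G : ℝ) ≤ t * (Fintype.card V : ℝ) ^ (2 / (t : ℝ)) := by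
  classical
  set n : ℝ := (Fintype.card V : ℝ)
  have hn : 1 ≤ n := Nat.one_le_cast.2 Fintype.card_pos
  have hn0 : 0 < n := by linarith
  obtain ⟨q, hq⟩ : ∃ q, (t + 1) / 2 = q + 1 := ⟨(t + 1) / 2 - 1, by omega⟩
  have hqt : 2 * q + 1 ≤ t := by omega
  have htq : (t : ℝ) ≤ 2 * (q + 1) := by exact_mod_cast (by omega : t ≤ 2 * (q + 1))
  have ht0 : (0 : ℝ) < t := by exact_mod_cast ht
  -- This `p` solves `p ^ (q + 1) * n = 1`, so that a vertex is charged at most `q + 1` for resets.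
  set p : ℝ := n ^ (-(1 / ((q : ℝ) + 1))) with hpdef
  have hp0 : 0 < p := Real.rpow_pos_of_pos hn0 _
  have hp1 : p ≤ 1 := Real.rpow_le_one_of_one_le_of_nonpos hn (by
    have : (0 : ℝ) ≤ 1 / ((q : ℝ) + 1) := by positivity
    linarith)
  have hpn : p ^ (q + 1) * n = 1 := by
    rw [hpdef, ← Real.rpow_natCast, ← Real.rpow_mul hn0.le]
    have : -(1 / ((q : ℝ) + 1)) * ((q + 1 : ℕ) : ℝ) = -1 := by
      push_cast
      field_simp
    rw [this, Real.rpow_neg_one, inv_mul_cancel₀ hn0.ne']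
  have hpinv : p⁻¹ ≤ n ^ (2 / (t : ℝ)) := by
    rw [hpdef, ← Real.rpow_neg hn0.le, neg_neg]
    refine Real.rpow_le_rpow_of_exponent_le hn ?_
    rw [div_le_div_iff₀ (by positivity) ht0]
    linarith
  have hD : arboricity G ≤ ⌊(t : ℝ) * n ^ (2 / (t : ℝ))⌋₊ := by
    refine arboricity_le_of_degenerate G _ fun U hU => ?_
    obtain ⟨v, hv, h⟩ := exists_card_neighbors_le hG hqt hp0.le hp1 hpn.le hU
    refine ⟨v, hv, Nat.le_floor ?_⟩
    have h2 : (2 * q + 1 : ℝ) ≤ t := by exact_mod_cast hqt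
    calc ((U.filter fun w => G.Adj v w).card : ℝ) ≤ t * p⁻¹ := by
          rw [← div_eq_mul_inv, le_div_iff₀ hp0]
          linarith
      _ ≤ t * n ^ (2 / (t : ℝ)) := mul_le_mul_of_nonneg_left hpinv ht0.le
  exact (Nat.le_floor_iff (by positivity)).1 hD

/-- A graph on at most one vertex is covered by no forests at all. -/
theorem arboricity_eq_zero_of_subsingleton [Fintype V] [Subsingleton V] (G : SimpleGraph V) :
    arboricity G = 0 := by
  classical
  refine Nat.le_zero.1 (arboricity_le_of_degenerate G 0 fun U ⟨v, hv⟩ => ⟨v, hv, ?_⟩)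
  rw [Nat.le_zero, Finset.card_eq_zero, Finset.filter_eq_empty_iff]
  exact fun w _ h => h.ne (Subsingleton.elim v w)

end PG

theorem mainTheorem2 :
    ∃ C : ℝ, 0 < C ∧
      ∀ (t : ℕ), 2 ≤ t →
        ∀ (V : Type*) [Fintype V] (G : SimpleGraph V), PG.IsPGGraph t G →
          (PG.arboricity G : ℝ) ≤
            (t : ℝ) ^ 3 * Real.log (Fintype.card V) ^ 3 *
              (Fintype.card V : ℝ) ^ (C / (t : ℝ)) := by
  refine ⟨2, two_pos, fun t ht V _ G hG => ?_⟩
  rcases Nat.lt_or_ge 1 (Fintype.card V) with hV | hV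
  · have : Nonempty V := Fintype.card_pos_iff.1 (by omega)
    refine (PG.arboricity_le_mul_rpow (by omega) hG).trans ?_
    refine mul_le_mul_of_nonneg_right ?_ (by positivity)
    -- The factor `t ^ 2 * log n ^ 3` is at least `4 * log 2 ^ 3 > 1`.
    have h2 : (0.69 : ℝ) ≤ Real.log (Fintype.card V) := by
      have h3 : Real.log 2 ≤ Real.log (Fintype.card V) :=
        Real.log_le_log two_pos (by exact_mod_cast hV)
      have := Real.log_two_gt_d9
      linarith
    have h4 : (0.69 : ℝ) ^ 3 ≤ Real.log (Fintype.card V) ^ 3 := by gcongr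
    have h5 : (2 : ℝ) ≤ t := by exact_mod_cast ht
    have h6 : (2 : ℝ) ^ 2 ≤ (t : ℝ) ^ 2 := by gcongr
    have h7 : (1 : ℝ) ≤ (t : ℝ) ^ 2 * Real.log (Fintype.card V) ^ 3 := by
      calc (1 : ℝ) ≤ 2 ^ 2 * 0.69 ^ 3 := by norm_num
        _ ≤ _ := by gcongr
    calc (t : ℝ) = t * 1 := (mul_one _).symm
      _ ≤ t * ((t : ℝ) ^ 2 * Real.log (Fintype.card V) ^ 3) := by gcongr
      _ = _ := by ring
  · have : Subsingleton V := Fintype.card_le_one_iff_subsingleton.1 hV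
    rw [PG.arboricity_eq_zero_of_subsingleton, Nat.cast_zero]
    have : 0 ≤ Real.log (Fintype.card V) := Real.log_natCast_nonneg _
    positivity
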